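/- Let $A$ be a C*-algebra (not necessarily unital), and let $E$ and $F$ be Hilbert C*-modules over $A$. Let $k : E \to F$ be a bounded $A$-linear map (not assumed to be adjointable). Let $E_0$ be a closed submodule of $E$ which is countably generated as a Hilbert $A$-module (i.e. there is a countable subset $S \subseteq E_0$ such that the linear span of $\{xa : x \in S,\ a \in A\}$ is dense in $E_0$), and suppose that $k$ is bounded below on $E_0$, i.e. there is a constant $c > 0$ with $\|kx\| \ge c\|x\|$ for all $x \in E_0$. Then $kE_0 = \{kx : x \in E_0\}$ is a closed submodule of $F$, and $E_0$ is isomorphic as a Hilbert $A$-module (that is, by an $A$-linear bijection preserving the $A$-valued inner product) to a closed submodule of $kE_0$. -/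

import Mathlib

/-!
Hilbert modules over a C⋆-algebra `A` (not necessarily unital) are complete `CStarModule A E`s.
In Mathlib's convention `A` acts on the left and the inner product satisfies
`inner A x (a • y) = a * inner A x y`. A right Hilbert module over `B` is the same thing as a
Hilbert module in this sense over the opposite C⋆-algebra `A = Bᵐᵒᵖ`, so that statements about all
C⋆-algebras `A` do not depend on this choice of side.
-/

section HilbertModules

variable (A : Type*) [NonUnitalCStarAlgebra A] [PartialOrder A]

/-- A closed submodule of a Hilbert `A`-module `E`: a norm-closed linear subspace of `E`
that is stable under the action of `A`. -/
structure HilbertSubmodule (E : Type*) [NormedAddCommGroup E] [NormedSpace ℂ E] [SMul A E]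
    [CStarModule A E] extends Submodule ℂ E where
  isClosed' : IsClosed carrier
  smul_mem_left' : ∀ (a : A) {x : E}, x ∈ carrier → a • x ∈ carrier

/-- The Hilbert `A`-module `E` is countably generated: for some countable set `s ⊆ E`, the linear
span of the elements `a • x` with `a ∈ A` and `x ∈ s` is dense in `E`. -/
def IsCountablyGeneratedHilbertModule (E : Type*) [NormedAddCommGroup E] [NormedSpace ℂ E]
    [SMul A E] [CStarModule A E] : Prop :=
  ∃ s : Set E, s.Countable ∧
    Dense (Submodule.span ℂ {y : E | ∃ a : A, ∃ x ∈ s, y = a • x} : Set E)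

/-- An isomorphism of Hilbert `A`-modules: a linear bijection which is `A`-linear and preserves
the `A`-valued inner product. -/
structure HilbertModuleIso (E F : Type*) [NormedAddCommGroup E] [NormedSpace ℂ E]
    [SMul A E] [CStarModule A E] [NormedAddCommGroup F] [NormedSpace ℂ F] [SMul A F]
    [CStarModule A F] extends E ≃ₗ[ℂ] F where
  map_smul_left' : ∀ (a : A) (x : E), toFun (a • x) = a • toFun x
  inner_map' : ∀ x y : E, inner A (toFun x) (toFun y) = inner A x y

end HilbertModules

namespace HilbertSubmodule

variable {A : Type*} [NonUnitalCStarAlgebra A] [PartialOrder A]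
  {E : Type*} [NormedAddCommGroup E] [NormedSpace ℂ E] [SMul A E] [CStarModule A E]

instance : SetLike (HilbertSubmodule A E) E where
  coe S := S.carrier
  coe_injective S T h := by
    cases S; cases T; congr; exact SetLike.coe_injective h

/-- Closed submodules are ordered by inclusion. -/
instance : PartialOrder (HilbertSubmodule A E) := .ofSetLike (HilbertSubmodule A E) E

instance : AddSubgroupClass (HilbertSubmodule A E) E where
  add_mem {S} _ _ hx hy := S.add_mem' hx hy
  zero_mem S := S.zero_mem'
  neg_mem {S} _ hx := S.toSubmodule.neg_mem hx

instance : SMulMemClass (HilbertSubmodule A E) ℂ E where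
  smul_mem {S} c _ hx := S.smul_mem' c hx

variable (S : HilbertSubmodule A E)

instance [CompleteSpace E] : CompleteSpace S :=
  S.isClosed'.completeSpace_coe

/-- The action of `A` on a closed submodule, by restriction. -/
instance : SMul A S where
  smul a x := ⟨a • (x : E), S.smul_mem_left' a x.2⟩

/-- A closed submodule is a Hilbert `A`-module with the restricted inner product. -/
instance : CStarModule A S where
  inner x y := inner A (x : E) (y : E)
  inner_add_right := CStarModule.inner_add_right
  inner_self_nonneg := CStarModule.inner_self_nonneg
  inner_self := CStarModule.inner_self.trans (Subtype.ext_iff (a2 := (0 : S))).symm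
  inner_op_smul_right := CStarModule.inner_op_smul_right
  inner_smul_right_complex := CStarModule.inner_smul_right_complex
  star_inner _ _ := CStarModule.star_inner _ _
  norm_eq_sqrt_norm_inner_self x := CStarModule.norm_eq_sqrt_norm_inner_self (x : E)

end HilbertSubmodule

/-!
Let `X = E₀` and let `T : X → F` be the restriction of `k`. The range of `T` is closed because `T`
is bounded below. If `T` were adjointable, the isometric part of its polar decomposition would
be the required embedding. In general it is not, but it becomes so after composition with a compact
operator: if `H = ∑ ⟪x n, ·⟫ • x n` for a norm-summable sequence of generators of `X`, then
`T H = ∑ ⟪x n, ·⟫ • T (x n)` is a norm-convergent series of rank-one maps, so it has an adjoint `S'`.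

The operator `R = S' T H` on `X` has dense range. Indeed, if `R` is adjointable and positive, a
vector `y` with `‖⟪x, y⟫‖² ≤ C ‖⟪x, R x⟫‖` for all `x` lies in the closure of the range of `R`
(`CStarModule.mem_closure_range`). Applied to `H` and `y = a • x n` this shows that `H` has dense
range; applied to `R` and `y = H v` it shows the same for `R`, since
`‖⟪x, H v⟫‖ ≤ ‖H x‖ ‖v‖ ≤ c⁻¹ ‖v‖ ‖T H x‖` and `‖T H x‖² = ‖⟪x, R x⟫‖`. Hence `Q = √R` has dense
range as well, and `Q x ↦ T H x`, which preserves inner products, extends to an inner product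
preserving map `U : X → F` with values in the closed range of `T`. Such a map is automatically
`A`-linear and its range is closed.

Square roots and resolvents are taken by continuous functional calculus in the C⋆-algebra
`CStarModule.adjointable A X` of adjointable operators on `X`.
-/

open Filter Topology

namespace CStarModule

/-! ### Adjoint pairs and the algebra of adjointable operators -/

section Basic

variable {A : Type*} [NonUnitalCStarAlgebra A] [PartialOrder A]
  {X : Type*} [NormedAddCommGroup X] [NormedSpace ℂ X] [SMul A X] [CStarModule A X]
  {Y : Type*} [NormedAddCommGroup Y] [NormedSpace ℂ Y] [SMul A Y] [CStarModule A Y]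

variable (A) in
lemma ext_inner_left {x y : X} (h : ∀ z, inner A z x = inner A z y) : x = y := by
  rw [← sub_eq_zero, ← inner_self (A := A), inner_sub_right, h, sub_self]

lemma add_smul_module (a b : A) (x : X) : (a + b) • x = a • x + b • x :=
  ext_inner_left A fun z ↦ by simp [add_mul]

lemma smul_smul_module (z : ℂ) (a : A) (x : X) : (z • a) • x = z • (a • x) :=
  ext_inner_left A fun w ↦ by simp [smul_mul_assoc]

lemma norm_smul_le_module (a : A) (x : X) : ‖a • x‖ ≤ ‖a‖ * ‖x‖ := by
  refine le_of_sq_le_sq ?_ (by positivity)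
  rw [norm_sq_eq A, inner_op_smul_right, inner_op_smul_left]
  calc ‖a * (inner A x x * star a)‖ ≤ ‖a‖ * (‖inner A x x‖ * ‖star a‖) :=
        (norm_mul_le _ _).trans (by gcongr; exact norm_mul_le _ _)
    _ = (‖a‖ * ‖x‖) ^ 2 := by rw [← norm_sq_eq A, norm_star]; ring

/-- A map that preserves inner products commutes with the action of the algebra. -/
lemma map_smul_of_inner_map (U : X → Y) (hU : ∀ x y, inner A (U x) (U y) = inner A x y)
    (a : A) (x : X) : U (a • x) = a • U x := by
  rw [← sub_eq_zero, ← inner_self (A := A)]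
  simp [hU, mul_assoc]

/-- `S'` is an adjoint of `S` with respect to the `A`-valued inner products. -/
def IsAdjointPair (A : Type*) [NonUnitalCStarAlgebra A] [PartialOrder A]
    {X : Type*} [NormedAddCommGroup X] [NormedSpace ℂ X] [SMul A X] [CStarModule A X]
    {Y : Type*} [NormedAddCommGroup Y] [NormedSpace ℂ Y] [SMul A Y] [CStarModule A Y]
    (S : X →L[ℂ] Y) (S' : Y →L[ℂ] X) : Prop :=
  ∀ x y, inner A (S x) y = inner A x (S' y)

lemma IsAdjointPair.symm {S : X →L[ℂ] Y} {S' : Y →L[ℂ] X} (h : IsAdjointPair A S S') :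
    IsAdjointPair A S' S := fun x y ↦ by
  rw [← star_inner, ← h, star_inner]

lemma IsAdjointPair.unique {S : X →L[ℂ] Y} {S' S'' : Y →L[ℂ] X} (h : IsAdjointPair A S S')
    (h' : IsAdjointPair A S S'') : S' = S'' := by
  ext y
  exact ext_inner_left A fun x ↦ by rw [← h, ← h']

lemma IsAdjointPair.sub {S T : X →L[ℂ] Y} {S' T' : Y →L[ℂ] X} (h : IsAdjointPair A S S')
    (h' : IsAdjointPair A T T') : IsAdjointPair A (S - T) (S' - T') := fun x y ↦ by
  simp [h x y, h' x y]

variable (A X) in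
/-- The algebra `ℒ(X)` of adjointable operators on a Hilbert module `X`, inside the algebra of
bounded operators. -/
def adjointable : Subalgebra ℂ (X →L[ℂ] X) where
  carrier := {T | ∃ T', IsAdjointPair A T T'}
  mul_mem' := by
    rintro S T ⟨S', hS⟩ ⟨T', hT⟩
    exact ⟨T' * S', fun x y ↦ by simp [hS (T x) y, hT x (S' y)]⟩
  add_mem' := by
    rintro S T ⟨S', hS⟩ ⟨T', hT⟩
    exact ⟨S' + T', fun x y ↦ by simp [hS x y, hT x y]⟩
  algebraMap_mem' z :=
    ⟨star z • 1, fun x y ↦ by simp [Algebra.algebraMap_eq_smul_one]⟩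

/-- The involution of `ℒ(X)` is the passage to the adjoint, which is unique. -/
noncomputable instance : Star (adjointable A X) where
  star T := ⟨T.2.choose, T, T.2.choose_spec.symm⟩

lemma isAdjointPair_star (T : adjointable A X) :
    IsAdjointPair A (T : X →L[ℂ] X) (star T : adjointable A X) :=
  T.2.choose_spec

lemma star_eq_of_isAdjointPair {T S : adjointable A X}
    (h : IsAdjointPair A (T : X →L[ℂ] X) (S : X →L[ℂ] X)) : star T = S :=
  Subtype.ext ((isAdjointPair_star T).unique h)

noncomputable instance : StarRing (adjointable A X) where
  star_involutive T := star_eq_of_isAdjointPair (isAdjointPair_star T).symm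
  star_mul S T := star_eq_of_isAdjointPair fun x y ↦ by
    simp [isAdjointPair_star S (T.1 x) y, isAdjointPair_star T x ((star S).1 y)]
  star_add S T := star_eq_of_isAdjointPair fun x y ↦ by
    simp [isAdjointPair_star S x y, isAdjointPair_star T x y]

instance : StarModule ℂ (adjointable A X) where
  star_smul z T := star_eq_of_isAdjointPair fun x y ↦ by
    simp [isAdjointPair_star T x y]

end Basic

/-! ### The C⋆-structure of `ℒ(X)`, and rank-one operators -/

section Bounded

variable {A : Type*} [NonUnitalCStarAlgebra A] [PartialOrder A] [StarOrderedRing A]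
  {X : Type*} [NormedAddCommGroup X] [NormedSpace ℂ X] [SMul A X] [CStarModule A X]
  {Y : Type*} [NormedAddCommGroup Y] [NormedSpace ℂ Y] [SMul A Y] [CStarModule A Y]

lemma IsAdjointPair.norm_le {S : X →L[ℂ] Y} {S' : Y →L[ℂ] X} (h : IsAdjointPair A S S') :
    ‖S'‖ ≤ ‖S‖ := by
  refine S'.opNorm_le_bound (norm_nonneg _) fun y ↦ ?_
  rcases (norm_nonneg (S' y)).eq_or_lt with h0 | h0
  · rw [← h0]; positivity
  refine le_of_mul_le_mul_right ?_ h0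
  calc ‖S' y‖ * ‖S' y‖ = ‖inner A (S (S' y)) y‖ := by rw [← sq, norm_sq_eq A, h]
    _ ≤ ‖S (S' y)‖ * ‖y‖ := norm_inner_le Y
    _ ≤ ‖S‖ * ‖S' y‖ * ‖y‖ := by gcongr; exact S.le_opNorm _
    _ = ‖S‖ * ‖y‖ * ‖S' y‖ := by ring

lemma IsAdjointPair.norm_mul_self_le {S : X →L[ℂ] Y} {S' : Y →L[ℂ] X}
    (h : IsAdjointPair A S S') : ‖S‖ * ‖S‖ ≤ ‖S' ∘L S‖ := by
  rw [← sq, ← Real.sqrt_le_sqrt_iff (norm_nonneg _), Real.sqrt_sq (norm_nonneg _)]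
  refine S.opNorm_le_bound (Real.sqrt_nonneg _) fun x ↦ ?_
  refine le_of_sq_le_sq ?_ (by positivity)
  rw [mul_pow, Real.sq_sqrt (norm_nonneg _)]
  calc ‖S x‖ ^ 2 = ‖inner A x (S' (S x))‖ := by rw [norm_sq_eq A, h]
    _ ≤ ‖x‖ * ‖(S' ∘L S) x‖ := norm_inner_le X
    _ ≤ ‖x‖ * (‖S' ∘L S‖ * ‖x‖) := by gcongr; exact (S' ∘L S).le_opNorm _
    _ = ‖S' ∘L S‖ * ‖x‖ ^ 2 := by ring

lemma isClosed_adjointable [CompleteSpace X] : IsClosed (adjointable A X : Set (X →L[ℂ] X)) := by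
  refine isClosed_of_closure_subset fun T hT ↦ ?_
  obtain ⟨T_, hmem, hlim⟩ := mem_closure_iff_seq_limit.1 hT
  choose T' hT' using hmem
  -- `T ↦ T'` is additive and does not increase the norm, so the adjoints form a Cauchy sequence.
  have hc : CauchySeq T' := by
    refine Metric.cauchySeq_iff.2 fun ε hε ↦ ?_
    obtain ⟨N, hN⟩ := Metric.cauchySeq_iff.1 hlim.cauchySeq ε hε
    refine ⟨N, fun m hm n hn ↦ (le_of_eq_of_le (dist_eq_norm _ _) ?_).trans_lt (hN m hm n hn)⟩
    rw [dist_eq_norm]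
    exact ((hT' m).sub (hT' n)).norm_le
  obtain ⟨S, hS⟩ := cauchySeq_tendsto_of_complete hc
  refine ⟨S, fun x y ↦ ?_⟩
  have h1 : Tendsto (fun n ↦ inner A (T_ n x) y) atTop (𝓝 (inner A (T x) y)) :=
    (continuous_inner.tendsto (T x, y)).comp
      ((((ContinuousLinearMap.apply ℂ X x).continuous.tendsto T).comp hlim).prodMk_nhds
        tendsto_const_nhds)
  have h2 : Tendsto (fun n ↦ inner A x (T' n y)) atTop (𝓝 (inner A x (S y))) :=
    (continuous_inner.tendsto (x, S y)).comp
      (tendsto_const_nhds.prodMk_nhds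
        (((ContinuousLinearMap.apply ℂ X y).continuous.tendsto S).comp hS))
  exact tendsto_nhds_unique h1 (h2.congr fun n ↦ (hT' n x y).symm)

instance [CompleteSpace X] : CompleteSpace (adjointable A X) :=
  isClosed_adjointable.completeSpace_coe

instance : CStarRing (adjointable A X) where
  norm_mul_self_le T := (isAdjointPair_star T).norm_mul_self_le

noncomputable instance [CompleteSpace X] : CStarAlgebra (adjointable A X) where

/-- The rank-one operator `x ↦ ⟪u, x⟫ • v`. -/
noncomputable def rankOne (A : Type*) [NonUnitalCStarAlgebra A] [PartialOrder A]
    [StarOrderedRing A]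
    {X : Type*} [NormedAddCommGroup X] [NormedSpace ℂ X] [SMul A X] [CStarModule A X]
    {Y : Type*} [NormedAddCommGroup Y] [NormedSpace ℂ Y] [SMul A Y] [CStarModule A Y]
    (u : X) (v : Y) : X →L[ℂ] Y :=
  LinearMap.mkContinuous
    { toFun x := inner A u x • v
      map_add' x y := by rw [inner_add_right, add_smul_module]
      map_smul' z x := by rw [inner_smul_right_complex, smul_smul_module]; rfl }
    (‖u‖ * ‖v‖) fun x ↦ by
      calc ‖inner A u x • v‖ ≤ ‖inner A u x‖ * ‖v‖ := norm_smul_le_module _ _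
        _ ≤ ‖u‖ * ‖x‖ * ‖v‖ := by gcongr; exact norm_inner_le X
        _ = ‖u‖ * ‖v‖ * ‖x‖ := by ring

lemma rankOne_apply (u : X) (v : Y) (x : X) : rankOne A u v x = inner A u x • v := rfl

lemma norm_rankOne_le (u : X) (v : Y) : ‖rankOne A u v‖ ≤ ‖u‖ * ‖v‖ :=
  LinearMap.mkContinuous_norm_le _ (by positivity) _

lemma isAdjointPair_rankOne (u : X) (v : Y) :
    IsAdjointPair A (rankOne A u v) (rankOne A v u) := fun x y ↦ by
  simp [rankOne_apply]

lemma IsAdjointPair.of_hasSum {ι : Type*} {S : ι → X →L[ℂ] Y} {S' : ι → Y →L[ℂ] X}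
    {T : X →L[ℂ] Y} {T' : Y →L[ℂ] X} (hS : HasSum S T) (hS' : HasSum S' T')
    (h : ∀ i, IsAdjointPair A (S i) (S' i)) : IsAdjointPair A T T' := fun x y ↦ by
  have h1 := ((hS.mapL (ContinuousLinearMap.apply ℂ Y x)).mapL (innerSL (A := A) y)).star
  have h2 := (hS'.mapL (ContinuousLinearMap.apply ℂ X y)).mapL (innerSL (A := A) x)
  simp only [ContinuousLinearMap.apply_apply, innerSL_apply, star_inner] at h1 h2
  exact h1.unique (by simpa only [h _ x y] using h2)

end Bounded

/-! ### Positive operators -/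

section PositiveOperators

variable {A : Type*} [NonUnitalCStarAlgebra A] [PartialOrder A] [StarOrderedRing A]
  {X : Type*} [NormedAddCommGroup X] [NormedSpace ℂ X] [SMul A X] [CStarModule A X]
  [CompleteSpace X]

lemma isAdjointPair_cfc (f : ℝ → ℝ) (R : adjointable A X) :
    IsAdjointPair A (cfc f R : adjointable A X).1 (cfc f R : adjointable A X).1 := by
  have h := isAdjointPair_star (cfc f R)
  rwa [(cfc_predicate f R : IsSelfAdjoint _).star_eq] at h

/-- An operator whose quadratic form is positive has positive spectrum: with
`m(r) = (r⁻)^{3/2}` and `r⁻ = max (-r) 0`, positivity of `⟪R⁻ x, R R⁻ x⟫ = -⟪m(R) x, m(R) x⟫`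
forces `m(R) = 0`. -/
lemma spectrum_nonneg_of_inner_nonneg {R : adjointable A X} (hR : IsSelfAdjoint R)
    (hpos : ∀ x, 0 ≤ inner A x (R.1 x)) : ∀ r ∈ spectrum ℝ R, 0 ≤ r := by
  let n : ℝ → ℝ := fun r ↦ max (-r) 0
  let m : ℝ → ℝ := fun r ↦ max (-r) 0 * √(max (-r) 0)
  have hn : Continuous n := by fun_prop
  have hm : Continuous m := by fun_prop
  have key : cfc m R * cfc m R = -(cfc n R * (R * cfc n R)) := by
    conv_rhs => enter [1, 2, 1]; rw [← cfc_id' ℝ R]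
    rw [← cfc_mul m m R, ← cfc_mul _ n R, ← cfc_mul n _ R, ← cfc_neg]
    refine cfc_congr fun r _ ↦ ?_
    rcases le_total r 0 with h | h
    · have h' : max (-r) 0 = -r := max_eq_left (by linarith)
      simp only [n, m, h']
      calc -r * √(-r) * (-r * √(-r)) = r ^ 2 * (√(-r) * √(-r)) := by ring
        _ = -(-r * (r * -r)) := by rw [Real.mul_self_sqrt (by linarith)]; ring
    · have h' : max (-r) 0 = 0 := max_eq_right (by linarith)
      simp [n, m, h']
  have hm0 : cfc m R = cfc (fun _ ↦ (0 : ℝ)) R := by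
    rw [cfc_const_zero]
    refine Subtype.ext (ContinuousLinearMap.ext fun x ↦ ?_)
    change (cfc m R).1 x = 0
    rw [← inner_self (A := A)]
    refine le_antisymm ?_ inner_self_nonneg
    have h1 : inner A ((cfc m R).1 x) ((cfc m R).1 x)
        = -inner A ((cfc n R).1 x) (R.1 ((cfc n R).1 x)) := by
      rw [isAdjointPair_cfc, isAdjointPair_cfc, ← inner_neg_right]
      exact congrArg (fun T : adjointable A X ↦ inner A x (T.1 x)) key
    rw [h1]
    exact neg_nonpos.2 (hpos _)
  intro r hr
  by_contra! hlt
  have h0 : max (-r) 0 * √(max (-r) 0) = 0 := eqOn_of_cfc_eq_cfc hm0 hm.continuousOn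
    continuousOn_const hR hr
  have : 0 < -r := by linarith
  rw [max_eq_left this.le] at h0
  have := mul_pos this (Real.sqrt_pos.2 this)
  linarith

variable {R : X →L[ℂ] X} (hR : IsAdjointPair A R R) (hpos : ∀ x, 0 ≤ inner A x (R x))

include hR hpos

lemma exists_sqrt : ∃ Q : X →L[ℂ] X, IsAdjointPair A Q Q ∧ Q ∘L Q = R := by
  let R' : adjointable A X := ⟨R, R, hR⟩
  have hsa : IsSelfAdjoint R' := star_eq_of_isAdjointPair hR
  have hspec := spectrum_nonneg_of_inner_nonneg hsa hpos
  refine ⟨(cfc Real.sqrt R').1, isAdjointPair_cfc _ _, ?_⟩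
  have : cfc Real.sqrt R' * cfc Real.sqrt R' = R' := by
    rw [← cfc_mul Real.sqrt Real.sqrt R']
    conv_rhs => rw [← cfc_id' ℝ R']
    exact cfc_congr fun r hr ↦ Real.mul_self_sqrt (hspec r hr)
  exact congrArg Subtype.val this

/-- A vector whose pairing with every `x` is controlled by the positive form `⟪x, R x⟫` lies in
the closure of the range of `R`. It is approximated by `R (R + t)⁻¹ y = y - g y` with
`g = t (R + t)⁻¹`; the hypothesis, applied to `g² y`, and `‖g R g‖ ≤ t` show that `g y → 0` as
`t → 0`. -/
lemma mem_closure_range {y : X} {C : ℝ}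
    (hy : ∀ x, ‖inner A x y‖ ^ 2 ≤ C * ‖inner A x (R x)‖) : y ∈ closure (Set.range R) := by
  let R' : adjointable A X := ⟨R, R, hR⟩
  have hsa : IsSelfAdjoint R' := star_eq_of_isAdjointPair hR
  have hspec := spectrum_nonneg_of_inner_nonneg hsa hpos
  -- `C` is nonnegative unless `y = 0`, as the hypothesis at `x = y` shows.
  have hC : 0 ≤ C ∨ y = 0 := by
    by_contra! h
    have h1 := hy y
    have h2 : 0 < ‖inner A y y‖ := norm_pos_iff.2 (by simpa [inner_self] using h.2)
    have h3 : C * ‖inner A y (R y)‖ ≤ 0 := mul_nonpos_of_nonpos_of_nonneg h.1.le (norm_nonneg _)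
    have := pow_pos h2 2
    linarith
  rcases hC with hC | rfl
  swap
  · exact subset_closure ⟨0, map_zero R⟩
  refine Metric.mem_closure_iff.2 fun ε hε ↦ ?_
  obtain ⟨t, ht, htε⟩ : ∃ t : ℝ, 0 < t ∧ C * t < ε ^ 2 := by
    refine ⟨ε ^ 2 / (C + 1), by positivity, ?_⟩
    rw [mul_div_assoc', div_lt_iff₀ (by positivity)]
    nlinarith [sq_pos_of_pos hε]
  let f : ℝ → ℝ := fun r ↦ (r + t)⁻¹
  let g : ℝ → ℝ := fun r ↦ t * (r + t)⁻¹
  have hne : ∀ r ∈ spectrum ℝ R', r + t ≠ 0 := fun r hr ↦ by linarith [hspec r hr]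
  have hf : ContinuousOn f (spectrum ℝ R') :=
    (continuousOn_id.add continuousOn_const).inv₀ hne
  have hg : ContinuousOn g (spectrum ℝ R') := continuousOn_const.mul hf
  have hfg : R' * cfc f R' = 1 - cfc g R' := by
    conv_lhs => enter [1]; rw [← cfc_id' ℝ R']
    rw [← cfc_mul (fun r ↦ r) f R' continuousOn_id hf, ← cfc_const_one ℝ R',
      ← cfc_sub _ g R' continuousOn_const hg]
    refine cfc_congr fun r hr ↦ ?_
    have := hne r hr
    simp only [f, g]
    field_simp
    ring
  have hgRg : ‖cfc g R' * (R' * cfc g R')‖ ≤ t := by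
    conv_lhs => enter [1, 2, 1]; rw [← cfc_id' ℝ R']
    rw [← cfc_mul (fun r ↦ r) g R' continuousOn_id hg, ← cfc_mul g (fun r ↦ r * g r) R' hg (continuousOn_id.mul hg)]
    refine norm_cfc_le ht.le fun r hr ↦ ?_
    have hr0 := hspec r hr
    have h1 : g r = t / (r + t) := (div_eq_mul_inv _ _).symm
    have h2 : 0 < r + t := by linarith
    have h3 : 0 ≤ g r := by rw [h1]; positivity
    have h4 : g r ≤ 1 := by rw [h1, div_le_one h2]; linarith
    have h5 : r * g r ≤ t := by rw [h1, mul_div_assoc', div_le_iff₀ h2]; nlinarith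
    rw [Real.norm_of_nonneg (by positivity)]
    calc g r * (r * g r) ≤ 1 * t := by gcongr
      _ = t := one_mul t
  set G : X →L[ℂ] X := (cfc g R').1 with hGdef
  have hG : IsAdjointPair A G G := isAdjointPair_cfc g R'
  refine ⟨R ((cfc f R').1 y), ⟨_, rfl⟩, ?_⟩
  have h1 : y - R ((cfc f R').1 y) = G y := by
    have : R ((cfc f R').1 y) = y - G y :=
      congrArg (fun T : adjointable A X ↦ T.1 y) hfg
    rw [this, sub_sub_cancel]
  rw [dist_eq_norm, h1]
  rcases (norm_nonneg (G y)).eq_or_lt with h0 | h0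
  · rwa [← h0]
  have h2 : ‖inner A (G (G y)) (R (G (G y)))‖ ≤ t * ‖G y‖ ^ 2 := by
    rw [hG]
    calc _ ≤ ‖G y‖ * ‖(G ∘L (R ∘L G)) (G y)‖ := norm_inner_le X
      _ ≤ ‖G y‖ * (t * ‖G y‖) := by
        gcongr
        exact (ContinuousLinearMap.le_opNorm _ _).trans (by gcongr; exact hgRg)
      _ = t * ‖G y‖ ^ 2 := by ring
  have h3 : (‖G y‖ ^ 2) ^ 2 ≤ C * t * ‖G y‖ ^ 2 := by
    calc (‖G y‖ ^ 2) ^ 2 = ‖inner A (G (G y)) y‖ ^ 2 := by rw [norm_sq_eq A, hG (G y) y]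
      _ ≤ C * ‖inner A (G (G y)) (R (G (G y)))‖ := hy _
      _ ≤ C * (t * ‖G y‖ ^ 2) := by gcongr
      _ = C * t * ‖G y‖ ^ 2 := by ring
  refine lt_of_pow_lt_pow_left₀ 2 hε.le (lt_of_le_of_lt ?_ htε)
  exact le_of_mul_le_mul_right (by linarith) (pow_pos h0 2)

end PositiveOperators

/-! ### Polar decomposition -/

section Polar

variable {A : Type*} [NonUnitalCStarAlgebra A] [PartialOrder A] [StarOrderedRing A]
  {X : Type*} [NormedAddCommGroup X] [NormedSpace ℂ X] [SMul A X] [CStarModule A X]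
  [CompleteSpace X]
  {Y : Type*} [NormedAddCommGroup Y] [NormedSpace ℂ Y] [SMul A Y] [CStarModule A Y]
  [CompleteSpace Y]

/-- Polar decomposition of an adjointable map `S` such that `S' S` has dense range: the isometry
is the continuous extension of `|S| x ↦ S x`. -/
lemma IsAdjointPair.exists_isometry {S : X →L[ℂ] Y} {S' : Y →L[ℂ] X} (h : IsAdjointPair A S S')
    (hd : DenseRange (S' ∘L S)) :
    ∃ U : X →L[ℂ] Y, (∀ x y, inner A (U x) (U y) = inner A x y) ∧
      ∀ x, U x ∈ closure (Set.range S) := by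
  obtain ⟨Q, hQ, hQQ⟩ := exists_sqrt (A := A) (R := S' ∘L S)
    (fun x y ↦ by simp only [ContinuousLinearMap.comp_apply]; rw [h.symm, h])
    (fun x ↦ by rw [ContinuousLinearMap.comp_apply, ← h]; exact inner_self_nonneg)
  have hin : ∀ x y, inner A (Q x) (Q y) = inner A (S x) (S y) := fun x y ↦ by
    rw [hQ, h]
    exact congrArg (fun T : X →L[ℂ] X ↦ inner A x (T y)) hQQ
  have hQd : DenseRange Q := by
    refine hd.mono ?_
    rw [← hQQ]
    rintro _ ⟨x, rfl⟩
    exact ⟨Q x, rfl⟩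
  have hn : ∀ x, ‖S x‖ ≤ 1 * ‖Q x‖ := fun x ↦ by
    rw [one_mul, norm_eq_sqrt_norm_inner_self (A := A), ← hin, ← norm_eq_sqrt_norm_inner_self]
  let U : X →L[ℂ] Y := (S : X →ₗ[ℂ] Y).extendOfNorm (Q : X →ₗ[ℂ] X)
  have hU : ∀ x, U (Q x) = S x := LinearMap.extendOfNorm_eq hQd ⟨1, hn⟩
  refine ⟨U, fun x y ↦ ?_, fun x ↦ ?_⟩
  · refine hQd.induction_on₂ (p := fun x y ↦ inner A (U x) (U y) = inner A x y) ?_ ?_ x y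
    · exact isClosed_eq
        (continuous_inner.comp
          ((U.continuous.comp continuous_fst).prodMk (U.continuous.comp continuous_snd)))
        continuous_inner
    · intro x y
      rw [hU, hU, hin]
  · refine hQd.induction_on (p := fun x ↦ U x ∈ closure (Set.range S)) x ?_ ?_
    · exact isClosed_closure.preimage U.continuous
    · exact fun x ↦ subset_closure ⟨x, (hU x).symm⟩

/-- A countably generated Hilbert module embeds isometrically into the closure of the range of
every bounded module map `T` on it that is bounded below. With generators rescaled to
`‖x n‖ ≤ 2⁻ⁿ`, the series `H = ∑ ⟪x n, ·⟫ • x n` is a strictly positive compact operator. Although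
`T` need not be adjointable, `T H = ∑ ⟪x n, ·⟫ • T (x n)` is, and its polar decomposition gives the
embedding. -/
lemma exists_isometry_of_bounded_below (hX : IsCountablyGeneratedHilbertModule A X)
    (T : X →L[ℂ] Y) (hT : ∀ (a : A) (x : X), T (a • x) = a • T x) {c : ℝ} (hc : 0 < c)
    (hbelow : ∀ x, c * ‖x‖ ≤ ‖T x‖) :
    ∃ U : X →L[ℂ] Y, (∀ x y, inner A (U x) (U y) = inner A x y) ∧
      ∀ x, U x ∈ closure (Set.range T) := by
  obtain ⟨s, hs, hdense⟩ := hX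
  obtain ⟨w, hw⟩ := Set.countable_iff_exists_subset_range.1 hs
  -- The factor `(1 + ‖w n‖)⁻¹` bounds the generators, and `2⁻ⁿ` makes the series converge.
  let δ : ℕ → ℝ := fun n ↦ (1 / 2) ^ n * (1 + ‖w n‖)⁻¹
  have hδ : ∀ n, 0 < δ n := fun n ↦ by positivity
  let x : ℕ → X := fun n ↦ δ n • w n
  have hx : ∀ n, ‖x n‖ ≤ (1 / 2) ^ n := fun n ↦ by
    rw [norm_smul, Real.norm_of_nonneg (hδ n).le, mul_assoc]
    refine mul_le_of_le_one_right (by positivity) ?_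
    rw [inv_mul_le_one₀ (by positivity)]
    linarith
  have hx1 : ∀ n, ‖x n‖ ≤ 1 := fun n ↦ (hx n).trans (pow_le_one₀ (by norm_num) (by norm_num))
  have hgeo : Summable fun n : ℕ ↦ ((1 : ℝ) / 2) ^ n :=
    summable_geometric_of_lt_one (by norm_num) (by norm_num)
  have hTx : ∀ n, ‖T (x n)‖ ≤ ‖T‖ * (1 / 2) ^ n := fun n ↦
    (T.le_opNorm _).trans (by gcongr; exact hx n)
  have hsum : Summable fun n ↦ rankOne A (x n) (x n) :=
    hgeo.of_norm_bounded fun n ↦ (norm_rankOne_le _ _).trans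
      ((mul_le_of_le_one_left (norm_nonneg _) (hx1 n)).trans (hx n))
  have hsum' : Summable fun n ↦ rankOne A (T (x n)) (x n) :=
    (hgeo.mul_left ‖T‖).of_norm_bounded fun n ↦ (norm_rankOne_le _ _).trans
      ((mul_le_of_le_one_right (norm_nonneg _) (hx1 n)).trans (hTx n))
  obtain ⟨H, hH⟩ := hsum
  obtain ⟨S', hS'⟩ := hsum'
  have hTH : HasSum (fun n ↦ rankOne A (x n) (T (x n))) (T ∘L H) := by
    have := hH.mapL (ContinuousLinearMap.compL ℂ X X Y T)
    have he : ∀ n, T ∘L rankOne A (x n) (x n) = rankOne A (x n) (T (x n)) := fun n ↦ by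
      ext z
      simp [rankOne_apply, hT]
    simp only [ContinuousLinearMap.compL_apply, he] at this
    exact this
  have hHsa : IsAdjointPair A H H :=
    .of_hasSum hH hH fun n ↦ isAdjointPair_rankOne _ _
  have hS : IsAdjointPair A (T ∘L H) S' :=
    .of_hasSum hTH hS' fun n ↦ isAdjointPair_rankOne _ _
  have hform : ∀ z, HasSum (fun n ↦ star (inner A z (x n)) * inner A z (x n)) (inner A z (H z)) := fun z ↦ by
    have := (hH.mapL (ContinuousLinearMap.apply ℂ X z)).mapL (innerSL (A := A) z)
    simpa [innerSL_apply, rankOne_apply] using this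
  have hHpos : ∀ z, 0 ≤ inner A z (H z) := fun z ↦
    (hform z).nonneg fun n ↦ star_mul_self_nonneg _
  have hHx : ∀ z n, ‖inner A z (x n)‖ ^ 2 ≤ ‖inner A z (H z)‖ := fun z n ↦ by
    rw [sq, ← CStarRing.norm_star_mul_self]
    exact CStarAlgebra.norm_le_norm_of_nonneg_of_le (star_mul_self_nonneg _)
      (le_hasSum (hform z) n fun m _ ↦ star_mul_self_nonneg _)
  have hHd : DenseRange H := by
    have hle : Submodule.span ℂ {y : X | ∃ a : A, ∃ x ∈ s, y = a • x} ≤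
        (LinearMap.range (H : X →ₗ[ℂ] X)).topologicalClosure := by
      refine Submodule.span_le.2 ?_
      rintro _ ⟨a, v, hv, rfl⟩
      obtain ⟨n, rfl⟩ := hw hv
      refine mem_closure_range hHsa hHpos (C := ‖a‖ ^ 2 * (δ n)⁻¹ ^ 2) fun z ↦ ?_
      have hwx : w n = (δ n)⁻¹ • x n := (inv_smul_smul₀ (hδ n).ne' _).symm
      rw [inner_op_smul_right, hwx, inner_smul_right_real]
      calc ‖a * (δ n)⁻¹ • inner A z (x n)‖ ^ 2 ≤ (‖a‖ * ((δ n)⁻¹ * ‖inner A z (x n)‖)) ^ 2 := by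
            gcongr
            refine (norm_mul_le _ _).trans_eq ?_
            rw [norm_smul, Real.norm_of_nonneg (inv_nonneg.2 (hδ n).le)]
        _ = ‖a‖ ^ 2 * (δ n)⁻¹ ^ 2 * ‖inner A z (x n)‖ ^ 2 := by ring
        _ ≤ ‖a‖ ^ 2 * (δ n)⁻¹ ^ 2 * ‖inner A z (H z)‖ := by gcongr; exact hHx z n
    exact dense_closure.1 (hdense.mono hle)
  have hRd : DenseRange (S' ∘L (T ∘L H)) := by
    refine dense_closure.1 (hHd.mono ?_)
    rintro _ ⟨v, rfl⟩
    refine mem_closure_range (A := A) (C := c⁻¹ ^ 2 * ‖v‖ ^ 2)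
      (fun y z ↦ by simp only [ContinuousLinearMap.comp_apply]; rw [hS.symm]; exact hS _ _)
      (fun z ↦ ?_) fun z ↦ ?_
    · rw [ContinuousLinearMap.comp_apply, ← hS]
      exact inner_self_nonneg
    · rw [ContinuousLinearMap.comp_apply, ← hS, ← norm_sq_eq A, ← hHsa, ← mul_pow, ← mul_pow]
      gcongr
      calc ‖inner A (H z) v‖ ≤ ‖H z‖ * ‖v‖ := norm_inner_le X
        _ ≤ c⁻¹ * ‖T (H z)‖ * ‖v‖ := by
          gcongr
          rw [← div_eq_inv_mul, le_div_iff₀ hc, mul_comm]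
          exact hbelow _
        _ = c⁻¹ * ‖v‖ * ‖T (H z)‖ := by ring
  obtain ⟨U, hU, hUS⟩ := hS.exists_isometry hRd
  refine ⟨U, hU, fun z ↦ closure_mono ?_ (hUS z)⟩
  rintro _ ⟨z, rfl⟩
  exact ⟨H z, rfl⟩

end Polar

end CStarModule

/-! ### Module maps that are bounded below -/

theorem corollary8p1
    {A : Type*} [NonUnitalCStarAlgebra A] [PartialOrder A] [StarOrderedRing A]
    {E : Type*} [NormedAddCommGroup E] [NormedSpace ℂ E] [SMul A E] [CStarModule A E]
    [CompleteSpace E]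
    {F : Type*} [NormedAddCommGroup F] [NormedSpace ℂ F] [SMul A F] [CStarModule A F]
    [CompleteSpace F]
    (k : E →L[ℂ] F) (hk : ∀ (a : A) (x : E), k (a • x) = a • k x)
    (E₀ : HilbertSubmodule A E) (hE₀ : IsCountablyGeneratedHilbertModule A E₀)
    (hbelow : ∃ c : ℝ, 0 < c ∧ ∀ x ∈ E₀, c * ‖x‖ ≤ ‖k x‖) :
    ∃ kE₀ : HilbertSubmodule A F, (kE₀ : Set F) = k '' (E₀ : Set E) ∧
      ∃ G : HilbertSubmodule A F, G ≤ kE₀ ∧ Nonempty (HilbertModuleIso A E₀ G) := by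
  obtain ⟨c, hc, hbelow⟩ := hbelow
  let T : E₀ →L[ℂ] F := k ∘L E₀.toSubmodule.subtypeL
  have hT : ∀ (a : A) (x : E₀), T (a • x) = a • T x := fun a x ↦ hk a x
  have hTbelow : ∀ x, c * ‖x‖ ≤ ‖T x‖ := fun x ↦ hbelow x x.2
  have hTanti : AntilipschitzWith (Real.toNNReal c⁻¹) T :=
    AddMonoidHomClass.antilipschitz_of_bound T fun x ↦ by
      rw [Real.coe_toNNReal _ (inv_nonneg.2 hc.le), ← div_eq_inv_mul, le_div_iff₀ hc, mul_comm]
      exact hTbelow x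
  have hTclosed : IsClosed (Set.range T) := hTanti.isClosed_range T.uniformContinuous
  obtain ⟨U, hU, hUT⟩ := CStarModule.exists_isometry_of_bounded_below hE₀ T hT hc hTbelow
  rw [hTclosed.closure_eq] at hUT
  have hUsmul := CStarModule.map_smul_of_inner_map (A := A) U hU
  have hUiso : Isometry U := AddMonoidHomClass.isometry_of_norm U fun x ↦ by
    rw [CStarModule.norm_eq_sqrt_norm_inner_self (A := A), hU,
      ← CStarModule.norm_eq_sqrt_norm_inner_self]
  let kE₀ : HilbertSubmodule A F :=
    { LinearMap.range (T : E₀ →ₗ[ℂ] F) with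
      isClosed' := hTclosed
      smul_mem_left' := by
        rintro a _ ⟨x, rfl⟩
        exact ⟨a • x, hT a x⟩ }
  let G : HilbertSubmodule A F :=
    { LinearMap.range (U : E₀ →ₗ[ℂ] F) with
      isClosed' := hUiso.isClosedEmbedding.isClosed_range
      smul_mem_left' := by
        rintro a _ ⟨x, rfl⟩
        exact ⟨a • x, hUsmul a x⟩ }
  refine ⟨kE₀, ?_, G, ?_, ⟨?_⟩⟩
  · ext y
    constructor
    · rintro ⟨x, rfl⟩
      exact ⟨x, x.2, rfl⟩
    · rintro ⟨x, hx, rfl⟩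
      exact ⟨⟨x, hx⟩, rfl⟩
  · rintro _ ⟨x, rfl⟩
    exact hUT x
  · exact
      { LinearEquiv.ofInjective (U : E₀ →ₗ[ℂ] F) hUiso.injective with
        map_smul_left' := fun a x ↦ Subtype.ext (hUsmul a x)
        inner_map' := hU }
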